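/- **Conventions.** Let $F_q$ be the field with $q$ elements. The weight of a vector in $F_q[D]^n$ is the total number of nonzero coefficients of its entries. A matrix $G(D)\in F_q[D]^{k\times n}$ with row degrees $\gamma_i=\max_j\deg g_{ij}$ is *basic* if it has a polynomial right inverse, and *reduced basic* if moreover $\sum_i\gamma_i$ is minimal among all basic $k \times n$ matrices generating the same $F_q[D]$-submodule of $F_q[D]^n$. A *convolutional code with parameters* $(n,k,\gamma;m,d_f)_q$ is a submodule of $F_q[D]^n$ generated by the rows of a reduced basic matrix $G(D)\in F_q[D]^{k\times n}$ with $\gamma=\sum_i\gamma_i$ and $m=\max_i\gamma_i$, whose minimal weight of a nonzero element is $d_f$. It is *MDS* if it attains the generalized Singleton bound, i.e. $d_f=(n-k)(\lfloor\gamma/k\rfloor+1)+\gamma+1$. For $u=\sum_l u_lD^l$ and $v=\sum_l v_lD^l$ in $F_q[D]^n$ put $\langle u\mid v\rangle=\sum_l u_l\cdot v_l$; the *Euclidean dual* of a code $V$ is $V^\perp=\{u\in F_q[D]^n:\langle D^lu\mid v\rangle=0\text{ for all }v\in V,\ l\ge 0\}$. For a primitive $n$-th root of unity $\alpha$ in an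 extension of $F_q$, the *BCH code* of length $n$ with zeros $\alpha^b,\dots,\alpha^{b+\delta-2}$ (designed distance $\delta$) is the cyclic code generated by the least common multiple of the minimal polynomials over $F_q$ of these elements. **Theorem.** Let $q=2^t$ with $t\ge 3$, $n=q+1$, $a=q/2$ and $1\le i\le a-1$. Then there is an MDS convolutional code with parameters $(n,n-2i,2;1,2i+3)_q$. More precisely, let $\alpha\in F_{q^2}$ be any primitive $n$-th root of unity and $\beta$ any $F_q$-basis of $F_{q^2}$. For $0\le s\le i$ expand each entry of the row $(1,\alpha^{a-s},\alpha^{2(a-s)},\dots,\alpha^{(n-1)(a-s)})$ into the column of its two $\beta$-coordinates. Let $H$ be the resulting $(2i+2)\times n$ matrix over $F_q$ (in the order $s=0,1,\dots,i$), $H_0$ its first $2i$ rows ($s<i$) and $H_1$ its last two rows ($s=i$). Then $H$, $H_0$ and $H_1$ have linearly independent rows and are parity-check matrices of the BCH codes $B_2$, $B_1$ and $B$ with zeros $\alpha^{a-i},\dots,\alpha^{a+i+1}$; $\alpha^{a-i+1},\dots,\alpha^{a+i}$; and $\alpha^{a-i}$, respectively, and $B_2\subseteq B_1$, $B_2\subseteq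 B$. Let $\tilde H_1$ be $H_1$ with $2i-2$ zero rows added at the bottom. Then $G(D)=H_0+\tilde H_1D$ is a reduced basic matrix; the code $V$ that it generates has dimension $2i$, degree $2$ and memory $1$; and its Euclidean dual $V^\perp$ is an MDS convolutional code with parameters $(n,n-2i,2;1,2i+3)_q$. -/

import Mathlib

open Polynomial

namespace ConvCode

variable {F : Type*} [Field F]

/-! Convolutional codes of length `n` over `F`: submodules of `F[D]^n`.
The polynomial variable `X` of Mathlib plays the role of the delay operator `D`. -/

/-- The weight of a polynomial vector: the total number of nonzero coefficients. -/
def weight {n : ℕ} (v : Fin n → F[X]) : ℕ := ∑ j, (v j).support.card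

/-- The code `{u(D) G(D)}` generated by a polynomial matrix, i.e. the span of its rows. -/
noncomputable def rowModule {k n : ℕ} (G : Matrix (Fin k) (Fin n) F[X]) : Submodule F[X] (Fin n → F[X]) :=
  Submodule.span F[X] (Set.range G.row)

/-- The constraint length `γ_i = max_j deg g_ij` of the `i`-th row. -/
def rowDegree {k n : ℕ} (G : Matrix (Fin k) (Fin n) F[X]) (i : Fin k) : ℕ :=
  Finset.univ.sup fun j => (G i j).natDegree

/-- The overall constraint length `∑ γ_i`. -/
def constraintLength {k n : ℕ} (G : Matrix (Fin k) (Fin n) F[X]) : ℕ := ∑ i, rowDegree G i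

/-- The memory `max γ_i`. -/
def memory {k n : ℕ} (G : Matrix (Fin k) (Fin n) F[X]) : ℕ := Finset.univ.sup (rowDegree G)

/-- `G(D)` is basic: it has a polynomial right inverse. -/
def IsBasic {k n : ℕ} (G : Matrix (Fin k) (Fin n) F[X]) : Prop :=
  ∃ B : Matrix (Fin n) (Fin k) F[X], G * B = 1

/-- `G(D)` is reduced basic: it is basic, and its overall constraint length is the smallest one
among all basic generator matrices of the code that it generates. -/
def IsReducedBasic {k n : ℕ} (G : Matrix (Fin k) (Fin n) F[X]) : Prop :=
  IsBasic G ∧ ∀ G' : Matrix (Fin k) (Fin n) F[X], IsBasic G' → rowModule G' = rowModule G →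
    constraintLength G ≤ constraintLength G'

/-- `d` is the free distance of `C`: the minimal weight of a nonzero element of `C`. -/
def IsFreeDistance {n : ℕ} (C : Submodule F[X] (Fin n → F[X])) (d : ℕ) : Prop :=
  IsLeast {w | ∃ v ∈ C, v ≠ 0 ∧ weight v = w} d

/-- `C` is a convolutional code with parameters `(n, k, γ; m, d)` over `F`: it is generated by
a reduced basic `k × n` matrix with degree `γ` and memory `m`, and has free distance `d`. -/
def HasParameters {n : ℕ} (C : Submodule F[X] (Fin n → F[X])) (k γ m d : ℕ) : Prop :=
  (∃ G : Matrix (Fin k) (Fin n) F[X], IsReducedBasic G ∧ rowModule G = C ∧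
    constraintLength G = γ ∧ memory G = m) ∧ IsFreeDistance C d

/-- The generalized Singleton bound `(n - k)(⌊γ / k⌋ + 1) + γ + 1` for the free distance. -/
def singletonBound (n k γ : ℕ) : ℕ := (n - k) * (γ / k + 1) + γ + 1

/-- `C` is an MDS convolutional code: it attains the generalized Singleton bound. -/
def IsMDS {n : ℕ} (C : Submodule F[X] (Fin n → F[X])) : Prop :=
  ∃ k γ m d, HasParameters C k γ m d ∧ d = singletonBound n k γ

/-- The Euclidean inner product `⟨u(D) | v(D)⟩ = ∑_l u_l · v_l` of two polynomial vectors, where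
`u_l, v_l ∈ F^n` are the coefficients of `D^l`. -/
noncomputable def euclInner {n : ℕ} (u v : Fin n → F[X]) : F :=
  ∑ j, (u j).sum fun l c => c * (v j).coeff l

theorem euclInner_add {n : ℕ} (u u' v : Fin n → F[X]) :
    euclInner (u + u') v = euclInner u v + euclInner u' v := by
  unfold euclInner
  rw [← Finset.sum_add_distrib]
  refine Finset.sum_congr rfl fun j _ => ?_
  exact Polynomial.sum_add_index _ _ _ (by simp) (by intros; ring)

theorem euclInner_C_smul {n : ℕ} (c : F) (u v : Fin n → F[X]) :
    euclInner ((C c : F[X]) • u) v = c * euclInner u v := by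
  unfold euclInner
  rw [Finset.mul_sum]
  refine Finset.sum_congr rfl fun j _ => ?_
  rw [Pi.smul_apply, smul_eq_mul, ← Polynomial.smul_eq_C_mul,
    Polynomial.sum_smul_index _ _ _ (by simp), Polynomial.sum_def, Polynomial.sum_def,
    Finset.mul_sum]
  exact Finset.sum_congr rfl fun l _ => by ring

/-- The Euclidean dual of a convolutional code `C`: the `u(D)` all of whose shifts `D^l u(D)` are
orthogonal to every element of `C`. Since `C` is itself closed under multiplication by `D`, this
is orthogonality of all shifts of `u` to all shifts of the elements of `C`, and it is the
largest `F[D]`-submodule inside the orthogonal space of `C`. -/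
noncomputable def dual {n : ℕ} (C : Submodule F[X] (Fin n → F[X])) : Submodule F[X] (Fin n → F[X]) where
  carrier := {u | ∀ v ∈ C, ∀ l : ℕ, euclInner ((X ^ l : F[X]) • u) v = 0}
  zero_mem' := by
    intro v _ l
    simp [euclInner]
  add_mem' := by
    intro u u' hu hu' v hv l
    rw [smul_add, euclInner_add, hu v hv l, hu' v hv l, add_zero]
  smul_mem' := by
    intro p u hu v hv
    induction p using Polynomial.induction_on' with
    | add p r hp hr =>
      intro l
      rw [add_smul, smul_add, euclInner_add, hp l, hr l, add_zero]
    | monomial k c =>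
      intro l
      have h : (X ^ l : F[X]) • (monomial k c : F[X]) • u
          = (Polynomial.C c : F[X]) • (X ^ (l + k) : F[X]) • u := by
        rw [smul_smul, smul_smul, ← C_mul_X_pow_eq_monomial]
        congr 1
        ring
      rw [h, euclInner_C_smul, hu v hv, mul_zero]

/-! Block codes. -/

/-- The polynomial `c_0 + c_1 x + ... + c_{n-1} x^{n-1}` of a word `c ∈ F^n`. -/
noncomputable def wordPoly {n : ℕ} (c : Fin n → F) : F[X] := ∑ j : Fin n, C (c j) * X ^ (j : ℕ)

/-- The cyclic code of length `n` generated by `g`: the words whose polynomial lies, modulo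
`x^n - 1`, in the ideal generated by `g`. -/
def cyclicCode (n : ℕ) (g : F[X]) : Set (Fin n → F) :=
  {c | wordPoly c ∈ Ideal.span {g, X ^ n - 1}}

open Classical in
/-- The generator polynomial of a BCH code: the least common multiple of the minimal polynomials
over `F` of `α^b, ..., α^(b+δ-2)`, i.e. the product of the different ones among them. -/
noncomputable def bchGenerator (F : Type*) [Field F] {K : Type*} [Field K] [Algebra F K]
    (α : K) (b δ : ℕ) : F[X] :=
  ∏ f ∈ (Finset.Ico b (b + δ - 1)).image (fun j => minpoly F (α ^ j)), f

/-- The BCH code of length `n` with designed distance `δ` (for a primitive `n`-th root of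
unity `α`), with zeros `α^b, ..., α^(b+δ-2)`. -/
def bchCode (F : Type*) [Field F] {K : Type*} [Field K] [Algebra F K]
    (n : ℕ) (α : K) (b δ : ℕ) : Set (Fin n → F) :=
  cyclicCode n (bchGenerator F α b δ)

/-- `H` is a parity-check matrix of the block code `B`, with independent rows. -/
def IsParityCheck {r n : ℕ} (H : Matrix (Fin r) (Fin n) F) (B : Set (Fin n → F)) : Prop :=
  LinearIndependent F H.row ∧ ∀ c, c ∈ B ↔ H.mulVec c = 0

/-- The matrix over `K` with rows `(1, α^e, α^(2e), ..., α^((n-1)e))`, for `e = e_0, ..., e_{s-1}`,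
with each entry replaced by the column of its two coordinates in the `F`-basis `β` of `K`. -/
noncomputable def expandedMatrix {K : Type*} [Field K] [Algebra F K] (n : ℕ) (α : K)
    (β : Module.Basis (Fin 2) F K) {s : ℕ} (e : Fin s → ℕ) : Matrix (Fin (s * 2)) (Fin n) F :=
  Matrix.of fun r j => β.repr (α ^ ((j : ℕ) * e r.divNat)) r.modNat

/-- `H` with zero rows added at the bottom, so as to have `κ` rows (for `r ≤ κ`). -/
def padRows (κ : ℕ) {r n : ℕ} (H : Matrix (Fin r) (Fin n) F) : Matrix (Fin κ) (Fin n) F :=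
  Matrix.of fun x j => if h : (x : ℕ) < r then H ⟨x, h⟩ j else 0

/-- The polynomial matrix `G(D) = H₀ + H₁' D`, where `H₁'` is `H₁` padded with zero rows. -/
noncomputable def unitMemoryMatrix {κ r n : ℕ} (H₀ : Matrix (Fin κ) (Fin n) F)
    (H₁ : Matrix (Fin r) (Fin n) F) : Matrix (Fin κ) (Fin n) F[X] :=
  Matrix.of fun x j => C (H₀ x j) + C (padRows κ H₁ x j) * X

end ConvCode

namespace ConvCode

variable {F : Type*} [Field F]

/-! Since `n = q + 1 = 2a + 1`, the `q`-th power of `α^(a-s)` is its inverse `α^(a+1+s)`. Over `F`,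
the `m` zeros `α^(a-s)`, `s < m`, thus force `2m` consecutive zeros, and the BCH bound
(`lt_ncard_of_aeval_wordPoly_eq_zero`) gives distance at least `2i+3` for `B₂` and `2i+1` for `B₁`;
`B` has at least 2. As `H` has only `2i+2` rows, the first bound also makes its rows independent and
is attained (Singleton).

An element `u` of the dual satisfies `H₀ u_l + H̃₁ u_{l+1} = 0` for all `l`, and `H̃₁ u_0 = 0`
(`mem_dual_rowModule_pencil_iff`). So its lowest nonzero coefficient lies in `B` and its highest in
`B₁`. Either they coincide and lie in `B₂`, or the weight is at least `2 + (2i+1)`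
(`le_weight_of_mem_dual`); a constant word of `B₂` has weight `2i+3`.

For the structural claims, `(H₀; H₁)` is completed to an invertible matrix. Its inverse supplies a
constant right inverse of `G(D)`, and also an explicit generator of the dual of the same shape
(`exists_isReducedBasic_dual`). Such pencils are reduced basic (`isReducedBasic_pencil`): the
constant elements of the code they generate span too small a space for a basic generator of smaller
degree. -/

/-- The matrix pencil `A + L D`. -/
noncomputable def pencil {k n : ℕ} (A L : Matrix (Fin k) (Fin n) F) :
    Matrix (Fin k) (Fin n) F[X] :=
  Matrix.of fun x j => C (A x j) + C (L x j) * X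

/-! ### Reduced basic pencils -/

theorem pencil_mul_map_C {k n : ℕ} {A L : Matrix (Fin k) (Fin n) F} {B : Matrix (Fin n) (Fin k) F}
    (hA : A * B = 1) (hL : L * B = 0) : pencil A L * B.map C = 1 := by
  have h : pencil A L = A.map C + (X : F[X]) • L.map C := by
    ext1 x j
    simp only [pencil, Matrix.of_apply, Matrix.add_apply, Matrix.smul_apply, Matrix.map_apply,
      smul_eq_mul, mul_comm X]
  rw [h, Matrix.add_mul, Matrix.smul_mul, ← Matrix.map_mul, ← Matrix.map_mul, hA, hL]
  simp

theorem rowDegree_pencil {k n : ℕ} (A L : Matrix (Fin k) (Fin n) F) (x : Fin k) :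
    (L x = 0 → rowDegree (pencil A L) x = 0) ∧ (L x ≠ 0 → rowDegree (pencil A L) x = 1) := by
  constructor
  · intro h
    simp [rowDegree, pencil, h]
  · intro h
    apply le_antisymm
    · refine Finset.sup_le fun j _ => ?_
      simp only [pencil, Matrix.of_apply]
      compute_degree
    · obtain ⟨j, hj⟩ := Function.ne_iff.mp h
      refine le_trans ?_ (Finset.le_sup (f := fun j => (pencil A L x j).natDegree)
        (Finset.mem_univ j))
      apply le_natDegree_of_ne_zero
      simpa [pencil, coeff_C] using hj

theorem constraintLength_pencil {k n : ℕ} {A L : Matrix (Fin k) (Fin n) F} {P : Finset (Fin k)}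
    (hP : ∀ x, x ∈ P ↔ L x ≠ 0) : constraintLength (pencil A L) = P.card := by
  rw [constraintLength, Finset.card_eq_sum_ones, ← Finset.sum_subset (Finset.subset_univ P)]
  · exact Finset.sum_congr rfl fun x hx => (rowDegree_pencil A L x).2 ((hP x).1 hx)
  · intro x _ hx
    rw [hP, not_not] at hx
    exact (rowDegree_pencil A L x).1 hx

theorem memory_pencil {k n : ℕ} {A L : Matrix (Fin k) (Fin n) F} {x : Fin k} (hx : L x ≠ 0) :
    memory (pencil A L) = 1 := by
  apply le_antisymm
  · refine Finset.sup_le fun y _ => ?_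
    by_cases hy : L y = 0
    · rw [(rowDegree_pencil A L y).1 hy]
      exact zero_le_one
    · exact ((rowDegree_pencil A L y).2 hy).le
  · rw [← (rowDegree_pencil A L x).2 hx]
    exact Finset.le_sup (Finset.mem_univ x)

theorem mem_rowModule_iff {k n : ℕ} {G : Matrix (Fin k) (Fin n) F[X]} {u : Fin n → F[X]} :
    u ∈ rowModule G ↔ ∃ w : Fin k → F[X], Matrix.vecMul w G = u := by
  rw [rowModule, Submodule.mem_span_range_iff_exists_fun]
  simp only [Matrix.vecMul_eq_sum]
  rfl

/-- A constant element of the code generated by the pencil `A + L D` is a constant combination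
of the rows in which `D` does not occur. -/
theorem exists_vecMul_of_C_mem_rowModule_pencil {k n : ℕ} {A L : Matrix (Fin k) (Fin n) F}
    {B : Matrix (Fin n) (Fin k) F} (hA : A * B = 1) (hLB : L * B = 0) {P : Finset (Fin k)}
    (hP : ∀ x, x ∈ P ↔ L x ≠ 0) (hL : LinearIndependent F fun p : P => L p)
    {g : Fin n → F} (hg : (fun j => C (g j)) ∈ rowModule (pencil A L)) :
    ∃ c : Fin k → F, Matrix.vecMul c A = g ∧ ∀ p ∈ P, c p = 0 := by
  obtain ⟨w, hw⟩ := mem_rowModule_iff.1 hg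
  -- The constant right inverse recovers `w` from a constant word, so `w` is itself constant.
  have hwc : w = fun y => C (Matrix.vecMul g B y) := by
    have h := congrArg (fun v => Matrix.vecMul v (B.map C)) hw
    simp only [Matrix.vecMul_vecMul, pencil_mul_map_C hA hLB, Matrix.vecMul_one] at h
    rw [h]
    ext1 y
    simp [Matrix.vecMul, dotProduct]
  set c := Matrix.vecMul g B
  have hco (j : Fin n) : ∑ x, C (c x) * (C (A x j) + C (L x j) * X) = C (g j) := by
    have := congrFun hw j
    rw [hwc] at this
    simpa [Matrix.vecMul, dotProduct, pencil] using this
  refine ⟨c, ?_, ?_⟩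
  · ext j
    simpa [Matrix.vecMul, dotProduct, finsetSum_coeff] using congrArg (coeff · 0) (hco j)
  · have h1 : ∑ x, c x • L x = 0 := by
      ext j
      simpa [finsetSum_coeff, coeff_C, coeff_C_mul] using congrArg (coeff · 1) (hco j)
    have h2 : ∑ p : P, c p • L p = 0 := by
      rw [Finset.sum_coe_sort P fun x => c x • L x, ← h1]
      refine Finset.sum_subset (Finset.subset_univ P) fun x _ hx => ?_
      rw [hP, not_not] at hx
      rw [hx, smul_zero]
    intro p hp
    exact Fintype.linearIndependent_iff.1 hL (fun p => c p) h2 ⟨p, hp⟩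

/-- A pencil `A + L D` with a constant right inverse is reduced basic as soon as the nonzero rows
of `L` are independent. -/
theorem isReducedBasic_pencil {k n : ℕ} {A L : Matrix (Fin k) (Fin n) F}
    {B : Matrix (Fin n) (Fin k) F} (hA : A * B = 1) (hLB : L * B = 0) {P : Finset (Fin k)}
    (hP : ∀ x, x ∈ P ↔ L x ≠ 0) (hL : LinearIndependent F fun p : P => L p) :
    IsReducedBasic (pencil A L) := by
  classical
  refine ⟨⟨_, pencil_mul_map_C hA hLB⟩, fun G' ⟨B', hB'⟩ hG' => ?_⟩
  rw [constraintLength_pencil hP]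
  by_contra! hlt
  -- The constant rows of a cheaper competitor: every other row costs at least 1, so there are more
  -- than `k - |P|` of them.
  let Z : Finset (Fin k) := Finset.univ.filter fun x => rowDegree G' x = 0
  have hZ : Zᶜ.card ≤ constraintLength G' := by
    rw [Finset.card_eq_sum_ones, constraintLength]
    refine (Finset.sum_le_sum fun x hx => ?_).trans
      (Finset.sum_le_sum_of_subset (Finset.subset_univ Zᶜ))
    simp only [Z, Finset.mem_compl, Finset.mem_filter, Finset.mem_univ, true_and] at hx
    omega
  have hconst (x : Z) : ∃ c : Fin k → F, (∀ j, G' x j = C (Matrix.vecMul c A j)) ∧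
      ∀ p ∈ P, c p = 0 := by
    have hx : rowDegree G' x = 0 := (Finset.mem_filter.1 x.2).2
    have hg (j : Fin n) : G' x j = C ((G' x j).coeff 0) := by
      apply eq_C_of_natDegree_eq_zero
      have := Finset.le_sup (f := fun j => (G' x j).natDegree) (Finset.mem_univ j)
      rw [← Nat.le_zero, ← hx]
      exact this
    have hmem : (fun j => C ((G' x j).coeff 0)) ∈ rowModule (pencil A L) := by
      rw [← hG', ← funext hg]
      exact Submodule.subset_span ⟨x, rfl⟩
    obtain ⟨c, hc, hcP⟩ := exists_vecMul_of_C_mem_rowModule_pencil hA hLB hP hL hmem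
    exact ⟨c, fun j => by rw [hg j, hc], hcP⟩
  choose c hc hcP using hconst
  -- The constant rows of `G'` are combinations of only `k - |P|` rows of `A`, hence satisfy a
  -- nontrivial relation; this contradicts the right inverse `B'`.
  let φ : (Z → F) →ₗ[F] ((Pᶜ : Finset (Fin k)) → F) :=
    (Matrix.of fun (y : (Pᶜ : Finset (Fin k))) (x : Z) => c x y).mulVecLin
  have hφ : LinearMap.ker φ ≠ ⊥ := by
    apply LinearMap.ker_ne_bot_of_finrank_lt
    have h1 := Z.card_compl_add_card
    have h2 := P.card_compl_add_card
    simp only [Module.finrank_fintype_fun_eq_card, Fintype.card_coe]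
    omega
  obtain ⟨l, hl, hl0⟩ := Submodule.exists_mem_ne_zero_of_ne_bot hφ
  have hrel (y : Fin k) : ∑ x, l x * c x y = 0 := by
    by_cases hy : y ∈ P
    · exact Finset.sum_eq_zero fun x _ => by rw [hcP x y hy, mul_zero]
    · have := congrFun hl ⟨y, Finset.mem_compl.2 hy⟩
      simpa [φ, Matrix.mulVec, dotProduct, mul_comm] using this
  let w : Fin k → F[X] := fun x => if h : x ∈ Z then C (l ⟨x, h⟩) else 0
  have hw : Matrix.vecMul w G' = 0 := by
    ext1 j
    have h1 : Matrix.vecMul w G' j = ∑ x : Z, w x * G' x j := by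
      rw [Finset.sum_coe_sort Z fun x => w x * G' x j]
      refine (Finset.sum_subset (Finset.subset_univ Z) fun x _ hx => ?_).symm
      simp [w, hx]
    rw [h1]
    calc ∑ x : Z, w x * G' x j = C (∑ x : Z, l x * Matrix.vecMul (c x) A j) := by
          rw [map_sum]
          refine Finset.sum_congr rfl fun x _ => ?_
          simp [w, hc]
      _ = C (∑ y, (∑ x : Z, l x * c x y) * A y j) := by
          simp only [Matrix.vecMul, dotProduct, Finset.mul_sum, Finset.sum_mul]
          rw [Finset.sum_comm]
          simp only [mul_assoc]
      _ = 0 := by simp only [hrel, zero_mul, Finset.sum_const_zero, map_zero]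
  have hw0 : w = 0 := by
    have := congrArg (fun v => Matrix.vecMul v B') hw
    simpa [Matrix.vecMul_vecMul, hB'] using this
  apply hl0
  ext x
  simpa [w] using congrFun hw0 x

/-! The Euclidean dual. -/

/-- Both sums extend by zero to the union of the supports. This yields symmetry, hence linearity in
the second argument. -/
theorem euclInner_eq_sum_right {n : ℕ} (u v : Fin n → F[X]) :
    euclInner u v = ∑ j, (v j).sum fun l c => (u j).coeff l * c := by
  refine Finset.sum_congr rfl fun j _ => ?_
  rw [Polynomial.sum_def, Polynomial.sum_def]
  have h1 : ∑ l ∈ (u j).support ∪ (v j).support, (u j).coeff l * (v j).coeff l =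
      ∑ l ∈ (u j).support, (u j).coeff l * (v j).coeff l :=
    (Finset.sum_subset Finset.subset_union_left fun l _ hl => by
      rw [notMem_support_iff.1 hl, zero_mul]).symm
  rw [← h1]
  exact (Finset.sum_subset Finset.subset_union_right fun l _ hl => by
      rw [notMem_support_iff.1 hl, mul_zero]).symm

theorem euclInner_comm {n : ℕ} (u v : Fin n → F[X]) : euclInner u v = euclInner v u := by
  rw [euclInner_eq_sum_right, euclInner]
  exact Finset.sum_congr rfl fun j _ => by congr; ext; ring

theorem euclInner_shift_pencil {n : ℕ} (w : Fin n → F[X]) (g h : Fin n → F) (m : ℕ) :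
    euclInner w ((X ^ m : F[X]) • fun j => C (g j) + C (h j) * X) =
      ∑ j, (g j * (w j).coeff m + h j * (w j).coeff (m + 1)) := by
  rw [euclInner_eq_sum_right]
  refine Finset.sum_congr rfl fun j _ => ?_
  have : ((X ^ m : F[X]) • fun j => C (g j) + C (h j) * X) j =
      monomial m (g j) + monomial (m + 1) (h j) := by
    rw [← C_mul_X_pow_eq_monomial, ← C_mul_X_pow_eq_monomial, Pi.smul_apply, smul_eq_mul]
    ring
  rw [this, Polynomial.sum_add_index _ _ _ (by simp) (by intros; ring),
    sum_monomial_index _ _ (by simp), sum_monomial_index _ _ (by simp)]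
  ring

/-- By bilinearity it suffices to test on the shifts of the rows, which span the code over `F`. -/
theorem mem_dual_rowModule_iff {k n : ℕ} {G : Matrix (Fin k) (Fin n) F[X]} {u : Fin n → F[X]} :
    u ∈ dual (rowModule G) ↔
      ∀ x, ∀ l m : ℕ, euclInner ((X ^ l : F[X]) • u) ((X ^ m : F[X]) • G x) = 0 := by
  constructor
  · intro hu x l m
    exact hu _ (Submodule.smul_mem _ _ (Submodule.subset_span ⟨x, rfl⟩)) l
  · intro h v hv
    suffices h' : ∀ l m : ℕ, euclInner ((X ^ l : F[X]) • u) ((X ^ m : F[X]) • v) = 0 by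
      intro l
      simpa using h' l 0
    induction hv using Submodule.span_induction with
    | mem v hv =>
      obtain ⟨x, rfl⟩ := hv
      exact h x
    | zero =>
      intro l m
      simp [euclInner, Polynomial.sum_def]
    | add v v' _ _ hv hv' =>
      intro l m
      rw [smul_add, euclInner_comm, euclInner_add, euclInner_comm, hv, euclInner_comm, hv', add_zero]
    | smul p v _ hv =>
      induction p using Polynomial.induction_on' with
      | add p r hp hr =>
        intro l m
        rw [add_smul, smul_add, euclInner_comm, euclInner_add, euclInner_comm, hp, euclInner_comm,
          hr, add_zero]
      | monomial d c =>
        intro l m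
        have hm : (X ^ m : F[X]) • (monomial d c : F[X]) • v =
            (C c : F[X]) • (X ^ (m + d) : F[X]) • v := by
          rw [smul_smul, smul_smul, ← C_mul_X_pow_eq_monomial]
          congr 1
          ring
        rw [hm, euclInner_comm, euclInner_C_smul, euclInner_comm, hv, mul_zero]

/-- The dual of the code generated by `A + L D` is the kernel of the reversed pencil `A D + L`. -/
theorem mem_dual_rowModule_pencil_iff {k n : ℕ} {A L : Matrix (Fin k) (Fin n) F}
    {u : Fin n → F[X]} : u ∈ dual (rowModule (pencil A L)) ↔
      ∀ x, X * (A.map C).mulVec u x + (L.map C).mulVec u x = 0 := by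
  have hco (x : Fin k) (m : ℕ) :
      (X * (A.map C).mulVec u x + (L.map C).mulVec u x).coeff (m + 1) =
        ∑ j, (A x j * (u j).coeff m + L x j * (u j).coeff (m + 1)) := by
    rw [coeff_add, coeff_X_mul, Finset.sum_add_distrib]
    simp [Matrix.mulVec, dotProduct, finsetSum_coeff]
  have hco0 (x : Fin k) : (X * (A.map C).mulVec u x + (L.map C).mulVec u x).coeff 0 =
      ∑ j, L x j * (u j).coeff 0 := by
    rw [coeff_add, coeff_X_mul_zero, zero_add]
    simp [Matrix.mulVec, dotProduct, finsetSum_coeff]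
  rw [mem_dual_rowModule_iff]
  refine forall_congr' fun x => ?_
  have hrow (l m : ℕ) : euclInner ((X ^ l : F[X]) • u) ((X ^ m : F[X]) • pencil A L x) =
      ∑ j, (A x j * (X ^ l * u j).coeff m + L x j * (X ^ l * u j).coeff (m + 1)) :=
    euclInner_shift_pencil _ (A x) (L x) m
  simp only [hrow]
  constructor
  · intro h
    -- The constant coefficient needs a shift of `u` (`l = 1`, `m = 0`); the coefficient of
    -- `D^(m+1)` is the case `l = 0`.
    ext m
    rcases m with _ | m
    · rw [hco0, coeff_zero, ← h 1 0]
      simp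
    · rw [hco, coeff_zero, ← h 0 m]
      simp
  · intro h l m
    simp only [coeff_X_pow_mul']
    -- Only `m + 1 - l` matters: negative gives 0, zero gives the constant coefficient, positive
    -- gives the coefficient of that degree.
    rcases lt_trichotomy (m + 1) l with hl | rfl | hl
    · refine Finset.sum_eq_zero fun j _ => ?_
      rw [if_neg (by omega), if_neg (by omega), mul_zero, mul_zero, add_zero]
    · have h0 := hco0 x
      rw [h, coeff_zero] at h0
      refine Eq.trans ?_ h0.symm
      simp
    · obtain ⟨d, rfl⟩ := Nat.exists_eq_add_of_le (Nat.lt_succ_iff.1 hl)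
      rw [← coeff_zero (d + 1), ← h, hco]
      refine Finset.sum_congr rfl fun j _ => ?_
      rw [if_pos (by omega), if_pos (by omega), Nat.add_sub_cancel_left, add_assoc,
        Nat.add_sub_cancel_left]

/-! The free distance of the dual. -/

theorem weight_eq_sum {n : ℕ} (u : Fin n → F[X]) (S : Finset ℕ) (hS : ∀ j, (u j).support ⊆ S) :
    weight u = ∑ l ∈ S, {j | (u j).coeff l ≠ 0}.ncard := by
  classical
  have h (l : ℕ) : {j | (u j).coeff l ≠ 0}.ncard = ∑ j, if (u j).coeff l ≠ 0 then 1 else 0 := by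
    rw [Finset.sum_boole, Set.ncard_eq_toFinset_card']
    simp
  simp only [h]
  rw [Finset.sum_comm]
  refine Finset.sum_congr rfl fun j _ => ?_
  rw [Finset.sum_boole, Nat.cast_id]
  congr 1
  ext l
  simp only [mem_support_iff, Finset.mem_filter]
  exact ⟨fun hl => ⟨hS j (mem_support_iff.2 hl), hl⟩, fun hl => hl.2⟩

/-- The extreme nonzero coefficients of `u` have no neighbour on one side, so the recurrence `A c_l
+ L c_{l+1} = 0` puts the lowest in the kernel of `L` and the highest in that of `A`. At distinct
times their weights add up; at the same time the word lies in both kernels. -/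
theorem le_weight_of_mem_dual {k n d d₀ d₁ : ℕ} {A L : Matrix (Fin k) (Fin n) F}
    (h₀ : ∀ c, A.mulVec c = 0 → c ≠ 0 → d₀ ≤ {j | c j ≠ 0}.ncard)
    (h₁ : ∀ c, L.mulVec c = 0 → c ≠ 0 → d₁ ≤ {j | c j ≠ 0}.ncard)
    (h : ∀ c, A.mulVec c = 0 → L.mulVec c = 0 → c ≠ 0 → d ≤ {j | c j ≠ 0}.ncard)
    (hd : d ≤ d₀ + d₁) {u : Fin n → F[X]} (hu : u ∈ dual (rowModule (pencil A L))) (hu0 : u ≠ 0) :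
    d ≤ weight u := by
  classical
  rw [mem_dual_rowModule_pencil_iff] at hu
  let S : Finset ℕ := Finset.univ.biUnion fun j => (u j).support
  let c (l : ℕ) (j : Fin n) : F := (u j).coeff l
  have hS (l : ℕ) : l ∈ S ↔ c l ≠ 0 := by
    simp [S, c, Function.ne_iff]
  have hA (M : Matrix (Fin k) (Fin n) F) (x : Fin k) (l : ℕ) :
      ((M.map C).mulVec u x).coeff l = M.mulVec (c l) x := by
    simp [Matrix.mulVec, dotProduct, finsetSum_coeff, c]
  have hrec (l : ℕ) : A.mulVec (c l) + L.mulVec (c (l + 1)) = 0 := by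
    ext x
    simpa [hA] using congrArg (coeff · (l + 1)) (hu x)
  have hzero : L.mulVec (c 0) = 0 := by
    ext x
    simpa [hA] using congrArg (coeff · 0) (hu x)
  have hne : S.Nonempty := by
    obtain ⟨j, hj⟩ := Function.ne_iff.1 hu0
    obtain ⟨l, hl⟩ := Finset.nonempty_iff_ne_empty.2 (mt support_eq_empty.1 hj)
    exact ⟨l, Finset.mem_biUnion.2 ⟨j, Finset.mem_univ j, hl⟩⟩
  have hw := weight_eq_sum u S fun j => Finset.subset_biUnion_of_mem (fun j => (u j).support)
    (Finset.mem_univ j)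
  have hmax : A.mulVec (c (S.max' hne)) = 0 := by
    have : c (S.max' hne + 1) = 0 := by
      by_contra hc
      have := S.le_max' _ ((hS _).2 hc)
      omega
    simpa [this] using hrec (S.max' hne)
  have hmin : L.mulVec (c (S.min' hne)) = 0 := by
    rcases hm : S.min' hne with _ | m
    · exact hzero
    · have : c m = 0 := by
        by_contra hc
        have := S.min'_le _ ((hS _).2 hc)
        omega
      simpa [this] using hrec m
  have hmax0 := (hS _).1 (S.max'_mem hne)
  have hmin0 := (hS _).1 (S.min'_mem hne)
  rw [hw]
  by_cases heq : S.min' hne = S.max' hne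
  · rw [heq] at hmin
    exact (h _ hmax hmin hmax0).trans
      (Finset.single_le_sum (f := fun l => {j | (u j).coeff l ≠ 0}.ncard)
        (fun _ _ => Nat.zero_le _) (S.max'_mem hne))
  · refine hd.trans ((add_le_add (h₀ _ hmax hmax0) (h₁ _ hmin hmin0)).trans ?_)
    rw [add_comm, ← Finset.sum_pair (f := fun l => {j | (u j).coeff l ≠ 0}.ncard) heq]
    apply Finset.sum_le_sum_of_subset
    intro l hl
    rcases Finset.mem_insert.1 hl with rfl | hl
    · exact S.min'_mem hne
    · rw [Finset.mem_singleton.1 hl]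
      exact S.max'_mem hne

/-! ### Unit-memory matrices and generators of their duals -/

theorem mulVec_row_pencil {k l n : ℕ} (H : Matrix (Fin l) (Fin n) F)
    (A L : Matrix (Fin k) (Fin n) F) (x : Fin l) (y : Fin k) :
    (H.map C).mulVec (pencil A L y) x =
      C (∑ j, H x j * A y j) + C (∑ j, H x j * L y j) * X := by
  simp only [Matrix.mulVec, dotProduct, pencil, Matrix.of_apply, Matrix.map_apply, map_sum,
    Finset.sum_mul, ← Finset.sum_add_distrib, map_mul]
  exact Finset.sum_congr rfl fun j _ => by ring

theorem padRows_castLE {κ r n : ℕ} (hr : r ≤ κ) (H : Matrix (Fin r) (Fin n) F) (p : Fin r) :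
    padRows κ H (Fin.castLE hr p) = H p := by
  ext j
  simp [padRows]

theorem padRows_eq_zero {κ r n : ℕ} (H : Matrix (Fin r) (Fin n) F) {x : Fin κ}
    (hx : ¬ (x : ℕ) < r) : padRows κ H x = 0 := by
  ext j
  simp [padRows, hx]

theorem padRows_ne_zero_iff {κ r n : ℕ} {H : Matrix (Fin r) (Fin n) F}
    (hH : LinearIndependent F H.row) (x : Fin κ) : padRows κ H x ≠ 0 ↔ (x : ℕ) < r := by
  constructor
  · intro h
    by_contra hx
    exact h (padRows_eq_zero H hx)
  · intro hx h
    apply hH.ne_zero ⟨x, hx⟩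
    ext j
    simpa [padRows, hx] using congrFun h j

theorem padRows_mulVec_eq_zero_iff {κ r n : ℕ} (hr : r ≤ κ) (H : Matrix (Fin r) (Fin n) F)
    (c : Fin n → F) : (padRows κ H).mulVec c = 0 ↔ H.mulVec c = 0 := by
  constructor
  · intro h
    ext p
    have : padRows κ H (Fin.castLE hr p) ⬝ᵥ c = 0 := congrFun h (Fin.castLE hr p)
    rwa [padRows_castLE] at this
  · intro h
    ext x
    by_cases hx : (x : ℕ) < r
    · have : H ⟨x, hx⟩ ⬝ᵥ c = 0 := congrFun h ⟨x, hx⟩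
      rwa [← padRows_castLE hr H] at this
    · simp [Matrix.mulVec, padRows_eq_zero H hx]

/-- Independent rows can be completed to an invertible matrix. -/
theorem exists_invertible_extension {ι : Type} {n : ℕ} [Fintype ι] [DecidableEq ι]
    {v : ι → Fin n → F} (hv : LinearIndependent F v) :
    ∃ (S : Type) (_ : Fintype S) (_ : DecidableEq S) (M : Matrix (ι ⊕ S) (Fin n) F)
      (N : Matrix (Fin n) (ι ⊕ S) F), (∀ x, M (Sum.inl x) = v x) ∧ M * N = 1 ∧ N * M = 1 ∧
      Fintype.card ι + Fintype.card S = n := by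
  classical
  let b₀ := Module.Basis.sumExtend hv
  have hfin : Finite (ι ⊕ Module.Basis.sumExtendIndex hv) :=
    Module.Finite.finite_basis b₀
  have : Finite (Module.Basis.sumExtendIndex hv) := Finite.sum_right ι
  -- Passing to `Fin s` puts the index set in `Type`, whatever the universe of `F`.
  obtain ⟨s, ⟨e⟩⟩ := Finite.exists_equiv_fin (Module.Basis.sumExtendIndex hv)
  let b := b₀.reindex ((Equiv.refl ι).sumCongr e)
  refine ⟨Fin s, inferInstance, inferInstance, Matrix.of b,
    Matrix.of fun j x => b.repr (Pi.single j 1) x, ?_, ?_, ?_, ?_⟩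
  · intro x
    change b (Sum.inl x) = v x
    simp only [b, b₀, Module.Basis.sumExtend, Module.Basis.reindex_apply,
      Module.Basis.extend_apply_self]
    rfl
  · ext x y
    have h : ∑ j, b x j • (Pi.single j 1 : Fin n → F) = b x := by
      ext j
      simp [Finset.sum_apply, Pi.single_apply]
    have := congrArg (fun v => b.repr v y) h
    simpa [Matrix.mul_apply, Matrix.one_apply, Finsupp.single_apply] using this
  · ext j j'
    have := congrFun (b.sum_repr (Pi.single j 1)) j'
    simpa [Matrix.mul_apply, Matrix.one_apply, Finset.sum_apply, Pi.single_apply, eq_comm]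
      using this
  · have := Module.finrank_eq_card_basis b
    simpa using this.symm

/-- The unit-memory matrix made of two blocks of jointly independent rows is reduced basic. -/
theorem isReducedBasic_unitMemoryMatrix {κ r n : ℕ} (hr : r ≤ κ) (hr0 : 0 < r)
    {H₀ : Matrix (Fin κ) (Fin n) F} {H₁ : Matrix (Fin r) (Fin n) F}
    (hH : LinearIndependent F (Sum.elim H₀ H₁)) :
    IsReducedBasic (unitMemoryMatrix H₀ H₁) ∧ constraintLength (unitMemoryMatrix H₀ H₁) = r ∧
      memory (unitMemoryMatrix H₀ H₁) = 1 := by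
  classical
  obtain ⟨S, _, _, M, N, hM, hMN, -, -⟩ := exists_invertible_extension hH
  have hH₁ : LinearIndependent F H₁.row := hH.comp Sum.inr Sum.inr_injective
  let P : Finset (Fin κ) := Finset.univ.filter fun x => (x : ℕ) < r
  have hP (x : Fin κ) : x ∈ P ↔ padRows κ H₁ x ≠ 0 := by
    rw [padRows_ne_zero_iff hH₁]
    simp [P]
  have hPcard : P.card = r := by
    have : P = Finset.univ.map (Fin.castLEEmb hr) := by
      ext x
      simp only [P, Finset.mem_filter, Finset.mem_univ, true_and, Finset.mem_map]
      exact ⟨fun hx => ⟨⟨x, hx⟩, rfl⟩, fun ⟨p, hp⟩ => hp ▸ p.2⟩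
    rw [this, Finset.card_map, Finset.card_fin]
  have hL : LinearIndependent F fun p : P => padRows κ H₁ p := by
    have hlt (p : P) : (p.1 : ℕ) < r := (Finset.mem_filter.1 p.2).2
    have := hH₁.comp (fun p : P => (⟨p.1, hlt p⟩ : Fin r)) fun p p' h =>
      Subtype.ext (Fin.ext (Fin.mk.inj_iff.1 h))
    convert this using 1
    ext p j
    simp [padRows, hlt p]
  -- The columns of the inverse that are dual to `H₀`; they are orthogonal to `H₁`.
  let B : Matrix (Fin n) (Fin κ) F := Matrix.of fun j x => N j (Sum.inl (Sum.inl x))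
  have hMN' (x y) : ∑ j, M x j * N j y = if x = y then 1 else 0 := by
    have := congrFun (congrFun hMN x) y
    rwa [Matrix.mul_apply, Matrix.one_apply] at this
  have hA : H₀ * B = 1 := by
    ext x y
    have := hMN' (Sum.inl (Sum.inl x)) (Sum.inl (Sum.inl y))
    simp only [hM, Sum.inl.injEq] at this
    rw [Matrix.mul_apply, Matrix.one_apply]
    exact this
  have hLB : padRows κ H₁ * B = 0 := by
    ext x y
    by_cases hx : (x : ℕ) < r
    · have := hMN' (Sum.inl (Sum.inr ⟨x, hx⟩)) (Sum.inl (Sum.inl y))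
      rw [hM, if_neg (by simp)] at this
      have hpx : padRows κ H₁ x = H₁ ⟨x, hx⟩ := padRows_castLE hr H₁ ⟨x, hx⟩
      rw [Matrix.mul_apply, hpx]
      exact this
    · simp [Matrix.mul_apply, padRows_eq_zero H₁ hx]
  have hx : padRows κ H₁ (Fin.castLE hr ⟨0, hr0⟩) ≠ 0 := by
    rw [padRows_ne_zero_iff hH₁]
    exact hr0
  exact ⟨isReducedBasic_pencil hA hLB hP hL, (constraintLength_pencil hP).trans hPcard,
    memory_pencil hx⟩

/-- The dual of the code of a unit-memory matrix is again generated by a reduced basic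
matrix with the same degree and memory. -/
theorem exists_isReducedBasic_dual {κ r n : ℕ} (hr : r ≤ κ) (hr0 : 0 < r)
    {H₀ : Matrix (Fin κ) (Fin n) F} {H₁ : Matrix (Fin r) (Fin n) F}
    (hH : LinearIndependent F (Sum.elim H₀ H₁)) :
    ∃ G : Matrix (Fin (n - κ)) (Fin n) F[X], IsReducedBasic G ∧
      rowModule G = dual (rowModule (unitMemoryMatrix H₀ H₁)) ∧ constraintLength G = r ∧
      memory G = 1 := by
  classical
  obtain ⟨S, _, _, M, N, hM, hMN, hNM, hcard⟩ := exists_invertible_extension hH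
  have hMN' (x y) : ∑ j, M x j * N j y = if x = y then 1 else 0 := by
    have := congrFun (congrFun hMN x) y
    rwa [Matrix.mul_apply, Matrix.one_apply] at this
  simp only [Fintype.card_sum, Fintype.card_fin] at hcard
  let e : Fin (n - κ) ≃ Fin r ⊕ S := Fintype.equivOfCardEq (by simp; omega)
  -- In the coordinates `c = M u`, duality means that the `H₁`-coordinate `p` is `-D` times the
  -- `H₀`-coordinate `p`, and that the `H₀`-coordinates beyond `r` vanish. The remaining
  -- coordinates, selected by `f`, are free; substituting into `u = N c` gives the generators `A + L
  -- D` below.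
  let f : Fin r ⊕ S → (Fin κ ⊕ Fin r) ⊕ S :=
    Sum.elim (fun p => Sum.inl (Sum.inl (Fin.castLE hr p))) Sum.inr
  have hf : Function.Injective f := by
    rintro (p | s) (p' | s') h <;> simp [f, Fin.ext_iff] at h ⊢ <;> exact h
  let L₀ : Fin r ⊕ S → Fin n → F := Sum.elim (fun p j => - N j (Sum.inl (Sum.inr p))) 0
  let A : Matrix (Fin (n - κ)) (Fin n) F := Matrix.of fun y j => N j (f (e y))
  let L : Matrix (Fin (n - κ)) (Fin n) F := Matrix.of fun y => L₀ (e y)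
  let B : Matrix (Fin n) (Fin (n - κ)) F := Matrix.of fun j y => M (f (e y)) j
  have hML (x) (z : Fin r ⊕ S) : ∑ j, M x j * L₀ z j =
      if (∃ p, z = Sum.inl p ∧ x = Sum.inl (Sum.inr p)) then -1 else 0 := by
    rcases z with p | s
    · simp [L₀, hMN']
      split_ifs <;> simp
    · simp [L₀]
  have hA : A * B = 1 := by
    ext y y'
    simp only [Matrix.mul_apply, A, B, Matrix.of_apply, Matrix.one_apply]
    simp_rw [mul_comm (N _ _), hMN', hf.eq_iff, e.injective.eq_iff, eq_comm]
  have hLB : L * B = 0 := by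
    ext y y'
    simp only [Matrix.mul_apply, L, B, Matrix.of_apply, Matrix.zero_apply]
    simp_rw [mul_comm (L₀ _ _), hML]
    rw [if_neg]
    rintro ⟨p, -, h⟩
    rcases hz : e y' with p' | s <;> simp [hz, f] at h
  have hLne (p : Fin r) : L₀ (Sum.inl p) ≠ 0 := by
    intro h
    have := hML (Sum.inl (Sum.inr p)) (Sum.inl p)
    simp [h] at this
  let P : Finset (Fin (n - κ)) := Finset.univ.map
    ⟨fun p : Fin r => e.symm (Sum.inl p), e.symm.injective.comp Sum.inl_injective⟩
  have hP (y : Fin (n - κ)) : y ∈ P ↔ L y ≠ 0 := by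
    simp only [P, Finset.mem_map, Finset.mem_univ, true_and, Function.Embedding.coeFn_mk]
    constructor
    · rintro ⟨p, rfl⟩
      change L₀ (e (e.symm _)) ≠ 0
      rw [e.apply_symm_apply]
      exact hLne p
    · intro h
      rcases hz : e y with p | s
      · exact ⟨p, by rw [← hz, e.symm_apply_apply]⟩
      · exact absurd (show L₀ (e y) = 0 by rw [hz]; rfl) h
  have hL : LinearIndependent F fun y : P => L y := by
    rw [Fintype.linearIndependent_iff]
    intro c hc y
    obtain ⟨p, -, hp⟩ := Finset.mem_map.1 y.2
    have hy : e y = Sum.inl p := by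
      rw [← hp]
      exact e.apply_symm_apply _
    -- Pairing with row `p` of `H₁` isolates the coefficient at `y`.
    have h1 : ∑ j, M (Sum.inl (Sum.inr p)) j * (∑ z : P, c z • L z) j = 0 := by
      rw [hc]
      simp
    simp only [Finset.sum_apply, Pi.smul_apply, smul_eq_mul, Finset.mul_sum] at h1
    rw [Finset.sum_comm] at h1
    simp_rw [mul_left_comm (M _ _), ← Finset.mul_sum] at h1
    change ∑ z : P, c z * ∑ j, M (Sum.inl (Sum.inr p)) j * L₀ (e z) j = 0 at h1
    simp_rw [hML] at h1
    rw [Finset.sum_eq_single y] at h1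
    · rw [if_pos ⟨p, hy, rfl⟩] at h1
      simpa using h1
    · intro z _ hz
      rw [if_neg, mul_zero]
      rintro ⟨p', hz', h⟩
      simp only [Sum.inl.injEq, Sum.inr.injEq] at h
      rw [← h, ← hy] at hz'
      exact hz (Subtype.ext (e.injective hz'))
    · intro h
      exact absurd (Finset.mem_univ y) h
  have hMinl (x : Fin κ) : M (Sum.inl (Sum.inl x)) = H₀ x := hM _
  have hMinr (p : Fin r) : M (Sum.inl (Sum.inr p)) = H₁ p := hM _
  have hrow : rowModule (pencil A L) = dual (rowModule (pencil H₀ (padRows κ H₁))) := by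
    apply le_antisymm
    · rw [rowModule, Submodule.span_le]
      rintro _ ⟨y, rfl⟩
      rw [SetLike.mem_coe, mem_dual_rowModule_pencil_iff]
      intro x
      change X * (H₀.map C).mulVec (pencil A L y) x + ((padRows κ H₁).map C).mulVec
        (pencil A L y) x = 0
      rw [mulVec_row_pencil, mulVec_row_pencil]
      simp only [A, L, Matrix.of_apply, ← hMinl, hMN', hML]
      have hpad (v : Fin n → F) : ∑ j, padRows κ H₁ x j * v j =
          if h : (x : ℕ) < r then ∑ j, M (Sum.inl (Sum.inr ⟨x, h⟩)) j * v j else 0 := by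
        split_ifs with h
        · rw [hMinr]
          simp [padRows, h]
        · simp [padRows, h]
      rw [hpad, hpad]
      simp only [hMN', hML]
      rcases hz : e y with p | s
      · by_cases hx : (x : ℕ) < r
        · by_cases hxp : (x : ℕ) = p <;> simp [f, hx, hxp, Fin.ext_iff]
          intro p' h₁ h₂
          exact absurd (h₂.trans h₁.symm) hxp
        · have : ¬ (x : ℕ) = p := fun h => hx (h ▸ p.2)
          simp [f, hx, Fin.ext_iff, this]
      · simp [f]
    · intro u hu
      rw [mem_dual_rowModule_pencil_iff] at hu
      let c := (M.map C).mulVec u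
      have hc0 (x : Fin κ) : (H₀.map C).mulVec u x = c (Sum.inl (Sum.inl x)) := by
        simp [c, Matrix.mulVec, dotProduct, hMinl]
      have hc1 (p : Fin r) : ((padRows κ H₁).map C).mulVec u (Fin.castLE hr p) =
          c (Sum.inl (Sum.inr p)) := by
        simp [c, Matrix.mulVec, dotProduct, hMinr, padRows_castLE]
      have hu1 (p : Fin r) : c (Sum.inl (Sum.inr p)) =
          - (X * c (Sum.inl (Sum.inl (Fin.castLE hr p)))) := by
        rw [← hc1, ← hc0]
        exact eq_neg_of_add_eq_zero_right (hu _)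
      have hu2 (x : Fin κ) (hx : ¬ (x : ℕ) < r) : c (Sum.inl (Sum.inl x)) = 0 := by
        have := hu x
        rw [hc0] at this
        simpa [Matrix.mulVec, dotProduct, padRows_eq_zero H₁ hx] using this
      have huc (j : Fin n) : u j = ∑ z, C (N j z) * c z := by
        have : (N.map C).mulVec c = u := by
          rw [Matrix.mulVec_mulVec, ← Matrix.map_mul, hNM]
          simp
        conv_lhs => rw [← this]
        rfl
      rw [mem_rowModule_iff]
      refine ⟨fun y => c (f (e y)), ?_⟩
      ext1 j
      have hκ : ∑ x : Fin κ, C (N j (Sum.inl (Sum.inl x))) * c (Sum.inl (Sum.inl x)) =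
          ∑ p : Fin r, C (N j (Sum.inl (Sum.inl (Fin.castLE hr p)))) *
            c (Sum.inl (Sum.inl (Fin.castLE hr p))) := by
        refine Eq.trans ?_ (Finset.sum_map Finset.univ (Fin.castLEEmb hr)
          fun x => C (N j (Sum.inl (Sum.inl x))) * c (Sum.inl (Sum.inl x)))
        refine (Finset.sum_subset (Finset.subset_univ _) fun x _ hx => ?_).symm
        rw [hu2, mul_zero]
        intro h
        exact hx (Finset.mem_map.2 ⟨⟨x, h⟩, Finset.mem_univ _, rfl⟩)
      rw [huc, Fintype.sum_sum_type, Fintype.sum_sum_type, hκ]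
      change ∑ y, c (f (e y)) * (C (N j (f (e y))) + C (L₀ (e y) j) * X) = _
      rw [Equiv.sum_comp e fun z => c (f z) * (C (N j (f z)) + C (L₀ z j) * X),
        Fintype.sum_sum_type, ← Finset.sum_add_distrib]
      congr 1
      · refine Finset.sum_congr rfl fun p _ => ?_
        simp only [f, L₀, Sum.elim_inl, hu1, map_neg]
        ring
      · refine Finset.sum_congr rfl fun p _ => ?_
        simp only [f, L₀, Sum.elim_inr, Pi.zero_apply, map_zero]
        ring
  refine ⟨pencil A L, isReducedBasic_pencil hA hLB hP hL, hrow, ?_,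
    memory_pencil ((hP _).1 (Finset.mem_map.2 ⟨⟨0, hr0⟩, Finset.mem_univ _, rfl⟩))⟩
  rw [constraintLength_pencil hP, Finset.card_map, Finset.card_fin]

/-! ### BCH codes and their parity checks -/

theorem aeval_wordPoly {K : Type*} [Field K] [Algebra F K] {n : ℕ} (c : Fin n → F) (x : K) :
    aeval x (wordPoly c) = ∑ j, c j • x ^ (j : ℕ) := by
  simp [wordPoly, Algebra.smul_def]

/-- A BCH code consists of the words whose polynomial vanishes at the prescribed zeros. -/
theorem mem_bchCode_iff {K : Type*} [Field K] [Algebra F K] [Algebra.IsIntegral F K] {n : ℕ}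
    {α : K} (hα : α ^ n = 1) {b δ : ℕ} {c : Fin n → F} :
    c ∈ bchCode F n α b δ ↔
      ∀ e ∈ Finset.Ico b (b + δ - 1), aeval (α ^ e) (wordPoly c) = 0 := by
  classical
  constructor
  · intro hc e he
    obtain ⟨f, g, hfg⟩ := Ideal.mem_span_pair.1 hc
    have hroot : aeval (α ^ e) (bchGenerator F α b δ) = 0 := by
      have : minpoly F (α ^ e) ∣ bchGenerator F α b δ :=
        Finset.dvd_prod_of_mem _ (Finset.mem_image_of_mem (fun j => minpoly F (α ^ j)) he)
      exact (minpoly.dvd_iff).1 this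
    have hαe : (α ^ e) ^ n = 1 := by rw [pow_right_comm, hα, one_pow]
    rw [← hfg]
    simp [hroot, hαe]
  · intro h
    refine Ideal.mem_span_pair.2 ?_
    obtain ⟨f, hf⟩ : bchGenerator F α b δ ∣ wordPoly c := by
      -- Distinct monic irreducible polynomials are coprime, so their product divides once each
      -- factor does.
      refine Finset.prod_dvd_of_coprime ?_ ?_
      · intro f hf g hg hfg
        obtain ⟨e, -, rfl⟩ := Finset.mem_image.1 hf
        obtain ⟨e', -, rfl⟩ := Finset.mem_image.1 hg
        have h1 := minpoly.irreducible (Algebra.IsIntegral.isIntegral (R := F) (α ^ e))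
        have h2 := minpoly.irreducible (Algebra.IsIntegral.isIntegral (R := F) (α ^ e'))
        refine (h1.coprime_iff_not_dvd).2 fun hdvd => hfg ?_
        exact eq_of_monic_of_associated
          (minpoly.monic (Algebra.IsIntegral.isIntegral _))
          (minpoly.monic (Algebra.IsIntegral.isIntegral _)) (h1.associated_of_dvd h2 hdvd)
      · intro f hf
        obtain ⟨e, he, rfl⟩ := Finset.mem_image.1 hf
        exact minpoly.dvd F _ (h e he)
    exact ⟨f, 0, by rw [hf]; ring⟩

/-- The BCH bound. -/
theorem lt_ncard_of_aeval_wordPoly_eq_zero {K : Type*} [Field K] [Algebra F K] {n : ℕ} {α : K}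
    (hα : IsPrimitiveRoot α n) {b m : ℕ} {c : Fin n → F} (hc : c ≠ 0)
    (h : ∀ e ∈ Finset.Ico b (b + m), aeval (α ^ e) (wordPoly c) = 0) :
    m < {j | c j ≠ 0}.ncard := by
  classical
  obtain ⟨j₀, hj₀⟩ := Function.ne_iff.1 hc
  have hα0 : α ≠ 0 := hα.ne_zero (fun h => by subst h; exact j₀.elim0)
  let S : Finset (Fin n) := Finset.univ.filter fun j => c j ≠ 0
  have hS : {j | c j ≠ 0}.ncard = S.card := by
    rw [Set.ncard_eq_toFinset_card']
    simp [S]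
  rw [hS]
  by_contra! hle
  have hj₀S : j₀ ∈ S := by simpa [S] using hj₀
  -- Consecutive zeros say that `c_j α^(jb)` is orthogonal to the values at `α^j` of every
  -- polynomial of degree below `m`.
  have key (p : K[X]) (hp : p.natDegree < m) :
      ∑ j, c j • (α ^ ((j : ℕ) * b) * p.eval (α ^ (j : ℕ))) = 0 := by
    have hk (k : ℕ) (hk : k < m) : ∑ j, c j • (α ^ ((j : ℕ) * b) * (α ^ (j : ℕ)) ^ k) = 0 := by
      rw [← h (b + k) (by simp [hk]), aeval_wordPoly]
      refine Finset.sum_congr rfl fun j _ => ?_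
      rw [← pow_mul, ← pow_mul, ← pow_add]
      congr 2
      ring
    simp_rw [eval_eq_sum_range' hp, Finset.mul_sum, Finset.smul_sum]
    rw [Finset.sum_comm]
    refine Finset.sum_eq_zero fun k hkm => ?_
    rw [← mul_zero (p.coeff k), ← hk k (Finset.mem_range.1 hkm), Finset.mul_sum]
    refine Finset.sum_congr rfl fun j _ => ?_
    rw [Algebra.smul_def, Algebra.smul_def]
    ring
  -- Vanishes on the support except at `j₀`, leaving a single nonzero term; its degree is `|S| - 1 <
  -- m`.
  let p : K[X] := ∏ j ∈ S.erase j₀, (X - C (α ^ (j : ℕ)))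
  have hp : p.natDegree < m := by
    rw [natDegree_prod_of_monic _ _ fun j _ => monic_X_sub_C _]
    simp only [natDegree_X_sub_C, Finset.sum_const, smul_eq_mul, mul_one]
    exact (Finset.card_erase_lt_of_mem hj₀S).trans_le hle
  have := key p hp
  rw [Finset.sum_eq_single j₀] at this
  · rw [smul_eq_zero, mul_eq_zero] at this
    rcases this with h1 | h1 | h1
    · exact hj₀ h1
    · exact pow_ne_zero _ hα0 h1
    · rw [eval_prod, Finset.prod_eq_zero_iff] at h1
      obtain ⟨j, hj, hj0⟩ := h1
      rw [eval_sub, eval_X, eval_C, sub_eq_zero] at hj0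
      exact (Finset.mem_erase.1 hj).1 (Fin.ext (hα.pow_inj j₀.2 j.2 hj0)).symm
  · intro j _ hj
    by_cases hjS : j ∈ S
    · have : p.eval (α ^ (j : ℕ)) = 0 := by
        rw [eval_prod]
        exact Finset.prod_eq_zero (Finset.mem_erase.2 ⟨hj, hjS⟩) (by simp)
      rw [this, mul_zero, smul_zero]
    · have : c j = 0 := by simpa [S] using hjS
      rw [this, zero_smul]
  · intro h
    exact absurd (Finset.mem_univ _) h

/-- As `β.repr` is `F`-linear and `c` has entries in `F`, each pair of rows computes the coordinates
of one value of `wordPoly c`. -/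
theorem expandedMatrix_mulVec_eq_zero_iff {K : Type*} [Field K] [Algebra F K] {n : ℕ} {α : K}
    {β : Module.Basis (Fin 2) F K} {s : ℕ} {e : Fin s → ℕ} {c : Fin n → F} :
    (expandedMatrix n α β e).mulVec c = 0 ↔ ∀ x, aeval (α ^ e x) (wordPoly c) = 0 := by
  have h (r : Fin (s * 2)) : (expandedMatrix n α β e).mulVec c r =
      β.repr (aeval (α ^ e r.divNat) (wordPoly c)) r.modNat := by
    rw [aeval_wordPoly, map_sum, Finsupp.finsetSum_apply, Matrix.mulVec, dotProduct]
    refine Finset.sum_congr rfl fun j _ => ?_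
    rw [map_smul, Finsupp.smul_apply, smul_eq_mul, ← pow_mul, mul_comm (e _), mul_comm (c j)]
    rfl
  constructor
  · intro h0 x
    rw [← β.repr.map_eq_zero_iff]
    ext y
    have := h (finProdFinEquiv (x, y))
    have hxy := finProdFinEquiv.symm_apply_apply (x, y)
    rw [finProdFinEquiv_symm_apply, Prod.mk.injEq] at hxy
    rw [hxy.1, hxy.2, h0] at this
    exact this.symm
  · intro h0
    ext r
    rw [h, h0]
    simp

/-! Zero extension of words. -/

theorem mulVec_extend_castLE {k m n : ℕ} (hm : m ≤ n) (H : Matrix (Fin k) (Fin n) F)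
    (c : Fin m → F) : H.mulVec (Function.extend (Fin.castLE hm) c 0) =
      (H.submatrix id (Fin.castLE hm)).mulVec c := by
  have hinj := Fin.castLE_injective hm
  ext x
  rw [Matrix.mulVec, Matrix.mulVec, dotProduct, dotProduct]
  refine (Finset.sum_of_injOn (Fin.castLE hm) hinj.injOn
    (fun _ _ => Finset.mem_coe.2 (Finset.mem_univ _)) ?_ ?_).symm
  · intro j _ hj
    rw [Function.extend_apply' _ _ _ fun ⟨y, hy⟩ =>
      hj ⟨y, Finset.mem_coe.2 (Finset.mem_univ _), hy⟩, Pi.zero_apply, mul_zero]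
  · intro j _
    rw [hinj.extend_apply]
    rfl

theorem ncard_extend_castLE_le {m n : ℕ} (hm : m ≤ n) (c : Fin m → F) :
    {j | Function.extend (Fin.castLE hm) c 0 j ≠ 0}.ncard ≤ m := by
  have h : {j | Function.extend (Fin.castLE hm) c 0 j ≠ 0} ⊆ Set.range (Fin.castLE hm) := by
    intro j hj
    by_contra hj'
    exact hj (Function.extend_apply' _ _ _ hj')
  refine (Set.ncard_le_ncard h).trans ?_
  rw [Set.ncard_range_of_injective (Fin.castLE_injective hm), Nat.card_fin]

theorem extend_castLE_ne_zero {m n : ℕ} (hm : m ≤ n) {c : Fin m → F} (hc : c ≠ 0) :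
    Function.extend (Fin.castLE hm) c 0 ≠ 0 := by
  intro h
  apply hc
  ext j
  rw [← (Fin.castLE_injective hm).extend_apply c 0 j, h]
  rfl

/-- No nonzero word supported on the first `r` positions is in the kernel, so the first `r` columns
form an invertible square block. -/
theorem linearIndependent_row_of_lt_ncard {r n : ℕ} (hr : r ≤ n) {H : Matrix (Fin r) (Fin n) F}
    (h : ∀ c, H.mulVec c = 0 → c ≠ 0 → r < {j | c j ≠ 0}.ncard) : LinearIndependent F H.row := by
  have hinj : Function.Injective (H.submatrix id (Fin.castLE hr)).mulVec := by
    rw [← Matrix.coe_mulVecLin, ← LinearMap.ker_eq_bot, LinearMap.ker_eq_bot']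
    intro c hc
    by_contra hc0
    rw [Matrix.mulVecLin_apply, ← mulVec_extend_castLE] at hc
    exact absurd (h _ hc (extend_castLE_ne_zero hr hc0)) (ncard_extend_castLE_le hr c).not_gt
  have hrow := Matrix.linearIndependent_rows_iff_isUnit.2 (Matrix.mulVec_injective_iff_isUnit.1 hinj)
  exact LinearIndependent.of_comp (LinearMap.funLeft F F (Fin.castLE hr)) hrow

/-- The first `m` columns give more unknowns than equations. With `m = r + 1` this is the Singleton
bound. -/
theorem exists_mulVec_eq_zero_of_lt {r m n : ℕ} (hr : r < m) (hm : m ≤ n)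
    (H : Matrix (Fin r) (Fin n) F) :
    ∃ c, H.mulVec c = 0 ∧ c ≠ 0 ∧ {j | c j ≠ 0}.ncard ≤ m := by
  have hker : LinearMap.ker (H.submatrix id (Fin.castLE hm)).mulVecLin ≠ ⊥ := by
    apply LinearMap.ker_ne_bot_of_finrank_lt
    simpa using hr
  obtain ⟨c, hc, hc0⟩ := Submodule.exists_mem_ne_zero_of_ne_bot hker
  refine ⟨_, ?_, extend_castLE_ne_zero hm hc0, ncard_extend_castLE_le hm c⟩
  rw [mulVec_extend_castLE]
  exact hc

theorem weight_C {n : ℕ} (c : Fin n → F) :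
    weight (fun j => C (c j)) = {j | c j ≠ 0}.ncard := by
  rw [weight_eq_sum _ {0} fun j => support_C_subset _]
  simp

theorem exists_isFreeDistance {n : ℕ} {V : Submodule F[X] (Fin n → F[X])} {v : Fin n → F[X]}
    (hv : v ∈ V) (hv0 : v ≠ 0) : ∃ d, IsFreeDistance V d :=
  ⟨_, Nat.sInf_mem (s := {w | ∃ v ∈ V, v ≠ 0 ∧ weight v = w}) ⟨_, v, hv, hv0, rfl⟩,
    fun _ hw => Nat.sInf_le hw⟩

/-! ### Conjugate zeros and the unit-memory BCH code -/

/-- Consecutive exponents around `n / 2` are closed under conjugation over a field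
with `n - 1` elements. -/
theorem forall_aeval_eq_zero_iff {K : Type*} [Field K] [Algebra F K] [Fintype F] {a m : ℕ}
    (hF : Fintype.card F = 2 * a) {α : K} (hα : α ^ (2 * a + 1) = 1) (hm : m ≤ a) (p : F[X]) :
    (∀ s : Fin m, aeval (α ^ (a - (s : ℕ))) p = 0) ↔
      ∀ e ∈ Finset.Ico (a + 1 - m) (a + 1 + m), aeval (α ^ e) p = 0 := by
  have hα0 : α ≠ 0 := by
    rintro rfl
    simp at hα
  -- Both sides are inverse to `α^(a-s)`: the exponents `a+1+s` and `a-s` add up to `2a+1`, which is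
  -- also `q+1`.
  have hconj (s : ℕ) (hs : s < a) : α ^ (a + 1 + s) = (α ^ (a - s)) ^ Fintype.card F := by
    apply mul_right_cancel₀ (pow_ne_zero (a - s) hα0)
    rw [← pow_add, ← pow_succ, hF, ← pow_mul, mul_comm (a - s), pow_mul, hα, one_pow, ← hα]
    congr 1
    omega
  constructor
  · intro h e he
    rw [Finset.mem_Ico] at he
    rcases le_or_gt e a with hea | hea
    · have := h ⟨a - e, by omega⟩
      rwa [Nat.sub_sub_self hea] at this
    · obtain ⟨s, rfl⟩ := Nat.exists_eq_add_of_le hea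
      have hs := h ⟨s, by omega⟩
      rw [Nat.succ_eq_add_one, hconj s (by omega)]
      -- The `q`-power Frobenius fixes `F`, so it maps zeros of `p` to zeros.
      have := aeval_algHom_apply (FiniteField.frobeniusAlgHom F K) (α ^ (a - s)) p
      rw [hs, map_zero, FiniteField.coe_frobeniusAlgHom] at this
      exact this
  · intro h s
    apply h
    rw [Finset.mem_Ico]
    omega

/-- The rows of the expanded matrix of `a, a - 1, ..., a - i` are those of the first `i`
exponents followed by those of the last one. -/
theorem sumElim_expandedMatrix {K : Type*} [Field K] [Algebra F K] {n : ℕ} {α : K}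
    {β : Module.Basis (Fin 2) F K} (a i : ℕ) :
    Sum.elim (expandedMatrix n α β fun s : Fin i => a - (s : ℕ))
        (expandedMatrix n α β fun _ : Fin 1 => a - i) =
      expandedMatrix n α β (fun s : Fin (i + 1) => a - (s : ℕ)) ∘
        Fin.cast (add_one_mul i 2 ▸ rfl : i * 2 + 1 * 2 = (i + 1) * 2) ∘ finSumFinEquiv := by
  funext x
  rcases x with x | x
  · rfl
  · have hx := x.2
    have h1 : (i * 2 + x.val) / 2 = i := by omega
    have h2 : (i * 2 + x.val) % 2 = x.val % 2 := by omega
    have h3 : (⟨(i * 2 + x.val) % 2, Nat.mod_lt _ two_pos⟩ : Fin 2) = x.modNat := Fin.ext h2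
    ext j
    change β.repr (α ^ ((j : ℕ) * (a - i))) x.modNat =
      β.repr (α ^ ((j : ℕ) * (a - (i * 2 + x.val) / 2))) ⟨(i * 2 + x.val) % 2, _⟩
    rw [h1, h3]

/-- The BCH codes of length `q + 1` with zeros around `q / 2` give a unit-memory code whose dual is
MDS. -/
theorem unit_memory_bch [Fintype F] {a n i : ℕ}
    (hF : Fintype.card F = 2 * a) (hn : n = 2 * a + 1) (hi : 1 ≤ i) (hia : i + 1 ≤ a)
    {K : Type*} [Field K] [Algebra F K] (β : Module.Basis (Fin 2) F K) {α : K}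
    (hα : IsPrimitiveRoot α n) :
    let H := expandedMatrix n α β (fun s : Fin (i + 1) => a - s)
    let H₀ := expandedMatrix n α β (fun s : Fin i => a - s)
    let H₁ := expandedMatrix n α β (fun _ : Fin 1 => a - i)
    let B₂ := bchCode F n α (a - i) (2 * i + 3)
    let B₁ := bchCode F n α (a - i + 1) (2 * i + 1)
    let B := bchCode F n α (a - i) 2
    let G := unitMemoryMatrix H₀ H₁
    let V := rowModule G
    (IsParityCheck H B₂ ∧ IsParityCheck H₀ B₁ ∧ IsParityCheck H₁ B ∧ B₂ ⊆ B₁ ∧ B₂ ⊆ B) ∧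
      (IsReducedBasic G ∧ ∃ d, HasParameters V (2 * i) 2 1 d) ∧
      HasParameters (dual V) (n - 2 * i) 2 1 (2 * i + 3) ∧ IsMDS (dual V) := by
  intro H H₀ H₁ B₂ B₁ B G V
  have hfin : Module.Finite F K := Module.Finite.of_basis β
  have hα1 : α ^ n = 1 := hα.pow_eq_one
  have hα1' : α ^ (2 * a + 1) = 1 := hn ▸ hα1
  -- The zeros of `B₂` are the window around `a + 1/2` with `m = i + 1`; those of `B₁` have `m = i`.
  have hB₂ (c : Fin n → F) : c ∈ B₂ ↔ H.mulVec c = 0 := by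
    rw [expandedMatrix_mulVec_eq_zero_iff, mem_bchCode_iff hα1,
      forall_aeval_eq_zero_iff hF hα1' hia, Nat.add_sub_add_right,
      show a - i + (2 * i + 3) - 1 = a + 1 + (i + 1) by omega]
  have hB₁ (c : Fin n → F) : c ∈ B₁ ↔ H₀.mulVec c = 0 := by
    rw [expandedMatrix_mulVec_eq_zero_iff, mem_bchCode_iff hα1,
      forall_aeval_eq_zero_iff hF hα1' (by omega),
      show a - i + 1 + (2 * i + 1) - 1 = a + 1 + i by omega, show a - i + 1 = a + 1 - i by omega]
  have hB (c : Fin n → F) : c ∈ B ↔ H₁.mulVec c = 0 := by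
    rw [expandedMatrix_mulVec_eq_zero_iff, mem_bchCode_iff hα1]
    simp
  have hd₂ (c : Fin n → F) (hc : H.mulVec c = 0) (hc0 : c ≠ 0) :
      2 * i + 3 ≤ {j | c j ≠ 0}.ncard := by
    rw [← hB₂, mem_bchCode_iff hα1] at hc
    exact lt_ncard_of_aeval_wordPoly_eq_zero (m := 2 * i + 2) hα hc0 hc
  have hd₁ (c : Fin n → F) (hc : H₀.mulVec c = 0) (hc0 : c ≠ 0) :
      2 * i + 1 ≤ {j | c j ≠ 0}.ncard := by
    rw [← hB₁, mem_bchCode_iff hα1] at hc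
    exact lt_ncard_of_aeval_wordPoly_eq_zero (m := 2 * i) hα hc0 hc
  have hd (c : Fin n → F) (hc : H₁.mulVec c = 0) (hc0 : c ≠ 0) : 2 ≤ {j | c j ≠ 0}.ncard := by
    rw [← hB, mem_bchCode_iff hα1] at hc
    exact lt_ncard_of_aeval_wordPoly_eq_zero (m := 1) hα hc0 hc
  have hH : LinearIndependent F H.row :=
    linearIndependent_row_of_lt_ncard (by omega) fun c hc hc0 => by
      have := hd₂ c hc hc0
      omega
  have hsum : LinearIndependent F (Sum.elim H₀ H₁) := by
    rw [sumElim_expandedMatrix]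
    exact hH.comp _ ((Fin.cast_injective _).comp finSumFinEquiv.injective)
  have hker (c : Fin n → F) : H.mulVec c = 0 ↔ H₀.mulVec c = 0 ∧ H₁.mulVec c = 0 := by
    simp only [H, H₀, H₁, expandedMatrix_mulVec_eq_zero_iff]
    rw [Fin.forall_fin_succ']
    simp
  have hr : 1 * 2 ≤ i * 2 := by omega
  obtain ⟨hG, hGc, hGm⟩ := isReducedBasic_unitMemoryMatrix hr (by omega) hsum
  obtain ⟨G', hG', hGV, hGc', hGm'⟩ := exists_isReducedBasic_dual hr (by omega) hsum
  have hV : ∃ d, HasParameters V (2 * i) 2 1 d := by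
    have hi0 : 0 < i * 2 := by omega
    obtain ⟨d, hdV⟩ := exists_isFreeDistance (V := V) (v := G ⟨0, hi0⟩)
      (Submodule.subset_span ⟨_, rfl⟩) (fun h => by
        obtain ⟨⟨R, hR⟩, -⟩ := hG
        have := congrFun (congrFun hR ⟨0, hi0⟩) ⟨0, hi0⟩
        rw [Matrix.mul_apply] at this
        change ∑ j, G ⟨0, hi0⟩ j * _ = _ at this
        simp [h] at this)
    rw [mul_comm 2 i]
    exact ⟨d, ⟨G, hG, rfl, hGc, hGm⟩, hdV⟩
  have hfree : IsFreeDistance (dual V) (2 * i + 3) := by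
    have hle : ∀ u ∈ dual V, u ≠ 0 → 2 * i + 3 ≤ weight u := by
      intro u hu hu0
      refine le_weight_of_mem_dual hd₁ (fun c hc => hd c ?_) (fun c hc hc' => hd₂ c ?_) (by omega)
        hu hu0
      · exact (padRows_mulVec_eq_zero_iff hr _ _).1 hc
      · exact (hker c).2 ⟨hc, (padRows_mulVec_eq_zero_iff hr _ _).1 hc'⟩
    refine ⟨?_, fun _ ⟨u, hu, hu0, hw⟩ => hw ▸ hle u hu hu0⟩
    -- `2i+3` unknowns against the `2i+2` rows of `H`; a constant word killed by both blocks lies in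
    -- the dual.
    obtain ⟨c, hc, hc0, hcard⟩ := exists_mulVec_eq_zero_of_lt (m := 2 * i + 3) (by omega)
      (by omega) H
    refine ⟨fun j => C (c j), ?_, ?_, ?_⟩
    · have hmap {k : ℕ} (M : Matrix (Fin k) (Fin n) F) (hM : M.mulVec c = 0) :
          (M.map C).mulVec (fun j => C (c j)) = 0 := by
        ext1 x
        have := congrArg C (congrFun hM x)
        simpa [Matrix.mulVec, dotProduct] using this
      refine mem_dual_rowModule_pencil_iff.2 fun x => ?_
      rw [hmap _ ((hker c).1 hc).1,
        hmap _ ((padRows_mulVec_eq_zero_iff hr _ _).2 ((hker c).1 hc).2)]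
      simp
    · intro h
      apply hc0
      ext j
      simpa using congrFun h j
    · rw [weight_C]
      exact hcard.antisymm (hd₂ c hc hc0)
  have hdual : HasParameters (dual V) (n - 2 * i) 2 1 (2 * i + 3) := by
    rw [mul_comm 2 i] at hfree ⊢
    exact ⟨⟨G', hG', hGV, hGc', hGm'⟩, hfree⟩
  refine ⟨⟨⟨hH, hB₂⟩, ⟨hsum.comp Sum.inl Sum.inl_injective, hB₁⟩,
    ⟨hsum.comp Sum.inr Sum.inr_injective, hB⟩, fun c hc => ?_, fun c hc => ?_⟩, ⟨hG, hV⟩, hdual,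
    _, _, _, _, hdual, ?_⟩
  · exact (hB₁ c).2 ((hker c).1 ((hB₂ c).1 hc)).1
  · exact (hB c).2 ((hker c).1 ((hB₂ c).1 hc)).2
  -- Here `n - 2i ≥ 3`, so the floor vanishes and the bound is `2i + 2 + 1`.
  · rw [singletonBound, Nat.div_eq_of_lt (show 2 < n - 2 * i by omega),
      Nat.sub_sub_self (by omega)]
    ring

/-- A quadratic extension of a finite field contains the roots of unity of order `q + 1`. -/
theorem exists_quadratic_extension_isPrimitiveRoot (F : Type*) [Field F] [Fintype F] :
    ∃ (K : Type) (_ : Field K) (_ : Algebra F K) (_ : Module.Basis (Fin 2) F K) (α : K),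
      IsPrimitiveRoot α (Fintype.card F + 1) := by
  obtain ⟨p, hp⟩ := CharP.exists F
  have : Fact p.Prime := ⟨CharP.char_is_prime F p⟩
  have hcard := FiniteField.natCard_extension F p 2
  obtain ⟨g, hg⟩ := IsCyclic.exists_generator (α := (FiniteField.Extension F p 2)ˣ)
  have hF : 1 < Fintype.card F := Fintype.one_lt_card
  -- A generator of the cyclic group of order `q² - 1 = (q+1)(q-1)`; its power `q - 1` has order `q
  -- + 1`.
  have hord : orderOf g = (Fintype.card F + 1) * (Fintype.card F - 1) := by
    rw [orderOf_eq_card_of_forall_mem_zpowers hg, Nat.card_units, hcard,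
      Nat.card_eq_fintype_card, ← Nat.sq_sub_sq, one_pow]
  have hg' := IsPrimitiveRoot.orderOf (g : FiniteField.Extension F p 2)
  rw [orderOf_units, hord] at hg'
  exact ⟨FiniteField.Extension F p 2, inferInstance, inferInstance,
    Module.finBasisOfFinrankEq _ _ (FiniteField.finrank_extension F p 2), _,
    hg'.pow (Nat.mul_pos (by omega) (by omega)) (mul_comm _ _)⟩

end ConvCode

theorem theorem4p2 {F : Type*} [Field F] [Fintype F] (t q n a i : ℕ) (ht : 3 ≤ t)
    (hq : q = 2 ^ t) (hF : Fintype.card F = q) (hn : n = q + 1) (ha : a = q / 2)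
    (hi : 1 ≤ i) (hia : i ≤ a - 1) :
    (∃ W : Submodule F[X] (Fin n → F[X]),
      ConvCode.HasParameters W (n - 2 * i) 2 1 (2 * i + 3) ∧ ConvCode.IsMDS W) ∧
    ∀ {K : Type*} [Field K] [Algebra F K] (β : Module.Basis (Fin 2) F K) (α : K),
      IsPrimitiveRoot α n →
      -- `H` is `H₀` on top of `H₁`
      let H := ConvCode.expandedMatrix n α β (fun s : Fin (i + 1) => a - s)
      let H₀ := ConvCode.expandedMatrix n α β (fun s : Fin i => a - s)
      let H₁ := ConvCode.expandedMatrix n α β (fun _ : Fin 1 => a - i)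
      let B₂ := ConvCode.bchCode F n α (a - i) (2 * i + 3)
      let B₁ := ConvCode.bchCode F n α (a - i + 1) (2 * i + 1)
      let B := ConvCode.bchCode F n α (a - i) 2
      let G := ConvCode.unitMemoryMatrix H₀ H₁
      let V := ConvCode.rowModule G
      (ConvCode.IsParityCheck H B₂ ∧ ConvCode.IsParityCheck H₀ B₁ ∧ ConvCode.IsParityCheck H₁ B ∧
        B₂ ⊆ B₁ ∧ B₂ ⊆ B) ∧
      (ConvCode.IsReducedBasic G ∧ ∃ d, ConvCode.HasParameters V (2 * i) 2 1 d) ∧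
      ConvCode.HasParameters (ConvCode.dual V) (n - 2 * i) 2 1 (2 * i + 3) ∧
      ConvCode.IsMDS (ConvCode.dual V) := by
  -- A positive exponent makes `q` even, so that `q / 2` is exact.
  obtain ⟨t, rfl⟩ := Nat.exists_eq_add_of_le' (le_trans (by decide : 1 ≤ 3) ht)
  have hqa : q = 2 * a := by
    rw [ha, hq, pow_succ]
    omega
  have hn' : n = 2 * a + 1 := by omega
  have hia' : i + 1 ≤ a := by omega
  refine ⟨?_, fun {K} _ _ β α hα =>
    ConvCode.unit_memory_bch (hF.trans hqa) hn' hi hia' β hα⟩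
  obtain ⟨K, _, _, β, α, hα⟩ := ConvCode.exists_quadratic_extension_isPrimitiveRoot F
  rw [hF, ← hn] at hα
  exact ⟨_, (ConvCode.unit_memory_bch (hF.trans hqa) hn' hi hia' β hα).2.2⟩
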